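/- For a discrete group $G$ let $BG$ be its classifying space, i.e. the geometric realization of the nerve of $G$ viewed as a category with one object, pointed by the unique vertex of the nerve. For pointed spaces $(X_1,x_1),\dots,(X_n,x_n)$ and an abstract simplicial complex $K$ on the vertex set $\{1,\dots,n\}$ (where $\varnothing\in K$), let $$Z_K(\underline{X})=\bigcup_{\sigma\in K}\{(z_1,\dots,z_n)\in X_1\times\cdots\times X_n : z_i=x_i\text{ for all } i\notin\sigma\}\subseteq X_1\times\cdots\times X_n$$ be the polyhedral product of the pairs $(X_i,x_i)$, with the subspace topology. If every $\{i\}$ is a simplex of $K$, then the coordinate axes define an inclusion $X_1\vee\cdots\vee X_n\to Z_K(\underline X)$. Let $H_1,\dots,H_n$ be subgroups of a finite group $G$ with trivial center. Let $\Gamma$ be the graph with vertex set $\{1,\dots,n\}$ in which $\{i,j\}$ (with $i\neq j$) is an edge if and only if $[H_i,H_j]=1$, regarded as a simplicial complex whose simplices are $\varnothing$, the vertices and the edges, and let $\mathrm{Flag}(\Gamma)$ be its flag complex, whose simplices are the sets of vertices that are pairwise joined by edges of $\Gamma$. Write $\underline{BH}=(BH_1,\dots,BH_n)$. 1. The map $BH_1\vee\cdots\vee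 BH_n\to BG$ induced by the inclusions $H_i\hookrightarrow G$ extends to $Z_{\mathrm{Flag}(\Gamma)}(\underline{BH})$: there is a continuous map $Z_{\mathrm{Flag}(\Gamma)}(\underline{BH})\to BG$ whose composite with the inclusion $BH_1\vee\cdots\vee BH_n\to Z_{\mathrm{Flag}(\Gamma)}(\underline{BH})$ is the given map. 2. More generally, for every simplicial complex $K$ on $\{1,\dots,n\}$ with $\Gamma\subseteq K\subseteq\mathrm{Flag}(\Gamma)$, the map $BH_1\vee\cdots\vee BH_n\to BG$ extends, in the same sense, to $Z_K(\underline{BH})$. -/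

import Mathlib

universe u

noncomputable section

namespace PolyhedralExtension

/-! ### Classifying spaces of discrete groups -/

section Classifying

open CategoryTheory Simplicial

/-- The classifying space `BG` of a discrete group `G`: the geometric realization of the nerve of
the one-object category with endomorphism monoid `G`. -/
def BSpace (G : Type u) [Group G] : TopCat.{u} :=
  SSet.toTop.{u}.obj (nerve (SingleObj G))

/-- The natural basepoint of `BG`: the point given by the unique vertex of the nerve. -/
def basePoint (G : Type u) [Group G] : BSpace G :=
  SSet.toTop.{u}.map
    (SSet.yonedaEquiv.symm (nerveEquiv.symm (SingleObj.star G)) : Δ[0] ⟶ nerve (SingleObj G))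
    (SSet.toTopSimplex.{u}.inv.app ⦋0⦌ default)

/-- The map `Bf : BG → BG'` induced by a group homomorphism `f : G → G'`. -/
def BMap {G G' : Type u} [Group G] [Group G'] (f : G →* G') : C(BSpace G, BSpace G') :=
  (SSet.toTop.{u}.map (nerveMap f.toFunctor)).hom

theorem BMap_basePoint {G G' : Type u} [Group G] [Group G'] (f : G →* G') :
    BMap f (basePoint G) = basePoint G' := by
  have h : (SSet.yonedaEquiv.symm (nerveEquiv.symm (SingleObj.star G)) :
      Δ[0] ⟶ nerve (SingleObj G)) ≫ nerveMap f.toFunctor =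
      SSet.yonedaEquiv.symm (nerveEquiv.symm (SingleObj.star G')) := by
    apply SSet.yonedaEquiv.injective
    rw [SSet.yonedaEquiv_comp]
    refine (congrArg _ (SSet.yonedaEquiv.apply_symm_apply _)).trans
      (Eq.trans ?_ (SSet.yonedaEquiv.apply_symm_apply _).symm)
    exact ComposableArrows.ext₀ rfl
  unfold BMap basePoint
  rw [← h, Functor.map_comp]
  rfl

end Classifying

/-! ### Wedges of pointed spaces -/

section Wedge

variable {ι : Type} {X : ι → Type u} [∀ i, TopologicalSpace (X i)]

/-- The relation on `{∗} ⊔ ⨆ᵢ Xᵢ` which glues every basepoint `xᵢ ∈ Xᵢ` to `∗`. -/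
inductive WedgeRel (x : ∀ i, X i) : (Unit ⊕ Σ i, X i) → (Unit ⊕ Σ i, X i) → Prop
  | glue (i : ι) : WedgeRel x (Sum.inr ⟨i, x i⟩) (Sum.inl ())

/-- The wedge `⋁ᵢ (Xᵢ, xᵢ)` with the quotient topology (a single point if `ι` is empty). -/
def Wedge (x : ∀ i, X i) : Type u := Quot (WedgeRel x)

instance (x : ∀ i, X i) : TopologicalSpace (Wedge x) :=
  inferInstanceAs (TopologicalSpace (Quot (WedgeRel x)))

/-- The map out of a wedge given by pointed continuous maps on the summands. -/
def Wedge.desc (x : ∀ i, X i) {Y : Type u} [TopologicalSpace Y] (y : Y)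
    (f : ∀ i, C(X i, Y)) (hf : ∀ i, f i (x i) = y) : C(Wedge x, Y) where
  toFun := Quot.lift (Sum.elim (fun _ => y) (fun p => f p.1 p.2)) (by
    rintro _ _ ⟨i⟩
    exact hf i)
  continuous_toFun := continuous_quot_lift _
    (continuous_const.sumElim (continuous_sigma fun i => (f i).continuous))

end Wedge

/-! ### Polyhedral products -/

section PolyhedralProduct

variable {ι : Type} {X : ι → Type u}

/-- The polyhedral product `Z_K(X, A) = ⋃_{σ ∈ K} D(σ)` inside `∏ᵢ Xᵢ`, where `D(σ)` is the product
of the `Xᵢ` for `i ∈ σ` and of the `Aᵢ` for `i ∉ σ`. It is used with the subspace topology. The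
complexes of Mathlib do not list the empty simplex, which belongs to every complex; it is put back
here. -/
def polyhedralProduct (K : AbstractSimplicialComplex ι) (A : ∀ i, Set (X i)) :
    Set (∀ i, X i) :=
  {z | ∃ σ : Finset ι, (σ = ∅ ∨ σ ∈ K) ∧ ∀ i, i ∉ σ → z i ∈ A i}

/-- `Z_K(X) = Z_K(X, ∗)` for pointed spaces `(Xᵢ, xᵢ)`. -/
abbrev PointedPolyhedralProduct (K : AbstractSimplicialComplex ι) (x : ∀ i, X i) : Type u :=
  polyhedralProduct K (fun i => {x i})

variable [DecidableEq ι] [∀ i, TopologicalSpace (X i)]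

/-- The inclusion of the `i`-th coordinate axis into `Z_K(X)`. -/
def axisInclusion (K : AbstractSimplicialComplex ι) (x : ∀ i, X i) (i : ι) :
    C(X i, PointedPolyhedralProduct K x) where
  toFun a := ⟨Function.update x i a, {i}, Or.inr (K.singleton_mem i), fun j hj => by
    rw [Finset.mem_singleton] at hj
    simp [Function.update_of_ne hj]⟩
  continuous_toFun := (continuous_const.update i continuous_id).subtype_mk _

/-- The inclusion `⋁ᵢ Xᵢ → Z_K(X)`, by the coordinate axes. -/
def wedgeInclusion (K : AbstractSimplicialComplex ι) (x : ∀ i, X i) :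
    C(Wedge x, PointedPolyhedralProduct K x) :=
  Wedge.desc x ⟨x, ∅, Or.inl rfl, fun _ _ => rfl⟩ (axisInclusion K x) fun i =>
    Subtype.ext (Function.update_eq_self i x)

end PolyhedralProduct

/-! ### The commutation graph and its flag complex -/

section Complexes

variable {ι : Type} [DecidableEq ι]

/-- The graph recording which of the subgroups `Hᵢ` commute: distinct `i, j` are joined iff
`[Hᵢ, Hⱼ] = 1`. -/
def commutationGraph {G : Type u} [Group G] (H : ι → Subgroup G) : SimpleGraph ι where
  Adj i j := i ≠ j ∧ ⁅H i, H j⁆ = ⊥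
  symm := ⟨fun i j h => ⟨h.1.symm, by rw [Subgroup.commutator_comm]; exact h.2⟩⟩
  loopless := ⟨fun _ h => h.1 rfl⟩

/-- A graph as a simplicial complex of dimension at most one: its simplices are its vertices and
edges. -/
def graphComplex (Γ : SimpleGraph ι) : AbstractSimplicialComplex ι where
  faces := {s | (∃ v, s = {v}) ∨ ∃ v w, Γ.Adj v w ∧ s = {v, w}}
  isRelLowerSet_faces := by
    rintro s (⟨v, rfl⟩ | ⟨v, w, h, rfl⟩)
    · refine ⟨Finset.singleton_nonempty v, fun t ht hn => Or.inl ⟨v, ?_⟩⟩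
      exact (Finset.subset_singleton_iff.mp ht).resolve_left hn.ne_empty
    · refine ⟨Finset.insert_nonempty v {w}, fun t ht hn => ?_⟩
      by_cases hv : v ∈ t <;> by_cases hw : w ∈ t
      · refine Or.inr ⟨v, w, h, Finset.Subset.antisymm ht ?_⟩
        grind
      · refine Or.inl ⟨v, ?_⟩
        grind
      · refine Or.inl ⟨w, ?_⟩
        grind
      · obtain ⟨a, ha⟩ := hn
        have := ht ha
        grind
  singleton_mem v := Or.inl ⟨v, rfl⟩

/-- The flag complex of `K`: a nonempty finite set of vertices is a simplex iff its points are
pairwise joined by edges of `K`. -/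
def flagComplex (K : AbstractSimplicialComplex ι) : AbstractSimplicialComplex ι where
  faces := {s | s.Nonempty ∧ ∀ v ∈ s, ∀ w ∈ s, v ≠ w → {v, w} ∈ K}
  isRelLowerSet_faces := fun _ hs =>
    ⟨hs.1, fun _ hts ht => ⟨ht, fun v hv w hw => hs.2 v (hts hv) w (hts hw)⟩⟩
  singleton_mem v := ⟨Finset.singleton_nonempty v, fun a ha b hb hab => by
    rw [Finset.mem_singleton] at ha hb
    exact absurd (ha.trans hb.symm) hab⟩

end Complexes

/-! ### The map to be extended -/

section Subgroups

variable {G : Type u} [Group G] {n : ℕ}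

/-- The basepoints of `BH₁, …, BHₙ`. -/
abbrev basePoints (H : Fin n → Subgroup G) : ∀ i, BSpace (H i) := fun i => basePoint (H i)

/-- The map `BH₁ ∨ ⋯ ∨ BHₙ → BG` induced by the inclusions `Hᵢ → G`. -/
def wedgeToB (H : Fin n → Subgroup G) : C(Wedge (basePoints H), BSpace G) :=
  Wedge.desc _ (basePoint G) (fun i => BMap (H i).subtype) fun i => BMap_basePoint (H i).subtype

/-- `BH₁ ∨ ⋯ ∨ BHₙ → BG` extends over the inclusion into `Z_K(BH₁, …, BHₙ)`. -/
def ExtendsTo (H : Fin n → Subgroup G) (K : AbstractSimplicialComplex (Fin n)) : Prop :=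
  ∃ F : C(PointedPolyhedralProduct K (basePoints H), BSpace G),
    F.comp (wedgeInclusion K (basePoints H)) = wedgeToB H

end Subgroups

end PolyhedralExtension

end

/-! If `σ` is a simplex of the flag complex, the `Hᵢ` with `i ∈ σ` commute elementwise, so
multiplying the coordinates in `σ` is a homomorphism `∏ᵢ Hᵢ → G`. Applying `B` and inverting `B(∏ᵢ
Hᵢ) → ∏ᵢ BHᵢ` gives `simplexMap`. These maps agree on overlaps of the pieces of `Z_K`, which form a
finite closed cover, so they glue to the extension.

The agreement and the bijectivity of `toPiB` rest on one device: a point of `BG` is encoded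
faithfully by a step function `[0, 1) → G` (`stepFun_injective`). The encoding is natural in `G` and
coordinatewise on products, so identities between points of `BG` become identities in `G` at each
time.

The topology is the other half, since `∏ᵢ BHᵢ` carries the ordinary product topology. Each `BHᵢ` is
Hausdorff and, as `Hᵢ` is finite, coherent with its compact skeleta. A finite product of such spaces
is coherent with the products of the stages (`isOpen_pi_of_isCompactFiltration`), which makes
`toPiB` a closed map. -/

noncomputable section

namespace PolyhedralExtension

/-! ### Cells of a geometric realization -/

section Realization

open CategoryTheory Simplicial Opposite

variable {S T : SSet.{u}}

/-- The characteristic map `Δⁿ → |S|` of an `n`-simplex of `S`. -/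
def cell {n : ℕ} (x : S _⦋n⦌) : C(stdSimplex ℝ (Fin (n + 1)), SSet.toTop.obj S) where
  toFun t := SSet.toTop.map (SSet.yonedaEquiv.symm x) ((SimplexCategory.toTopHomeo ⦋n⦌).symm t)
  continuous_toFun := (SSet.toTop.map (SSet.yonedaEquiv.symm x)).hom.continuous.comp
    (SimplexCategory.toTopHomeo ⦋n⦌).symm.continuous

theorem cell_map {m n : ℕ} (α : (⦋m⦌ : SimplexCategory) ⟶ ⦋n⦌) (x : S _⦋n⦌)
    (t : stdSimplex ℝ (Fin (m + 1))) :
    cell (S.map α.op x) t = cell x (stdSimplex.map α t) := by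
  have h : SSet.yonedaEquiv.symm (S.map α.op x) =
      SSet.stdSimplex.map α ≫ SSet.yonedaEquiv.symm x := by
    apply SSet.yonedaEquiv.injective
    rw [Equiv.apply_symm_apply, SSet.yonedaEquiv_comp, SSet.yonedaEquiv_map]
    rfl
  have h2 := SimplexCategory.toTopHomeo_symm_naturality_apply.{u} α t
  change SSet.toTop.map (SSet.yonedaEquiv.symm (S.map α.op x)) _ =
    SSet.toTop.map (SSet.yonedaEquiv.symm x) (SimplexCategory.toTopHomeo ⦋n⦌ |>.symm _)
  rw [h2, h, Functor.map_comp]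
  rfl

theorem map_cell (f : S ⟶ T) {n : ℕ} (x : S _⦋n⦌) (t : stdSimplex ℝ (Fin (n + 1))) :
    SSet.toTop.map f (cell x t) = cell (f.app _ x) t := by
  have h : SSet.yonedaEquiv.symm (f.app _ x) = SSet.yonedaEquiv.symm x ≫ f := by
    apply SSet.yonedaEquiv.injective
    rw [Equiv.apply_symm_apply, SSet.yonedaEquiv_comp, Equiv.apply_symm_apply]
  change _ = SSet.toTop.map (SSet.yonedaEquiv.symm (f.app _ x)) _
  rw [h, Functor.map_comp]
  rfl

theorem unit_app_eq_cell {n : ℕ} (x : S _⦋n⦌) :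
    TopCat.toSSetObjEquiv _ _ ((sSetTopAdj.unit.app S).app (op ⦋n⦌) x) = cell x := by
  ext t
  have := sSetTopAdj_unit_app_app_down S (op ⦋n⦌) x
  exact congrArg (fun f : SimplexCategory.toTop.{u}.obj ⦋n⦌ ⟶ SSet.toTop.obj S => f ⟨t⟩) this

theorem realization_hom_ext {Y : TopCat.{u}} {f g : SSet.toTop.obj S ⟶ Y}
    (h : ∀ (n : ℕ) (x : S _⦋n⦌) (t), f (cell x t) = g (cell x t)) : f = g := by
  apply (sSetTopAdj.homEquiv S Y).injective
  ext ⟨n⟩ x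
  induction n using SimplexCategory.rec with | _ n
  apply (TopCat.toSSetObjEquiv _ _).injective
  ext t
  have key : ∀ f : SSet.toTop.obj S ⟶ Y, TopCat.toSSetObjEquiv _ _
      (((sSetTopAdj.homEquiv S Y) f).app (op ⦋n⦌) x) t = f (cell x t) := by
    intro f
    rw [← unit_app_eq_cell, Adjunction.homEquiv_unit]
    rfl
  exact (key f).trans ((h n x t).trans (key g).symm)

/-- A compatible family `φ` is a simplicial map from `S` to the singular set of `Y`; its transpose
under the adjunction is the required map. -/
theorem exists_realization_desc {Y : TopCat.{u}}
    (φ : ∀ n : ℕ, S _⦋n⦌ → C(stdSimplex ℝ (Fin (n + 1)), Y))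
    (hφ : ∀ {m n : ℕ} (α : (⦋m⦌ : SimplexCategory) ⟶ ⦋n⦌) (x : S _⦋n⦌) (t),
      φ m (S.map α.op x) t = φ n x (stdSimplex.map α t)) :
    ∃ f : SSet.toTop.obj S ⟶ Y, ∀ (n : ℕ) (x : S _⦋n⦌) (t), f (cell x t) = φ n x t := by
  let F : S ⟶ TopCat.toSSet.obj Y :=
    { app := fun n => TypeCat.ofHom fun x => (TopCat.toSSetObjEquiv Y n).symm (φ n.unop.len x)
      naturality := by
        rintro ⟨n⟩ ⟨m⟩ ⟨α⟩
        induction n using SimplexCategory.rec with | _ n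
        induction m using SimplexCategory.rec with | _ m
        ext x
        apply (TopCat.toSSetObjEquiv _ _).injective
        ext t
        exact hφ α x t }
  refine ⟨(sSetTopAdj.homEquiv S Y).symm F, fun n x t => ?_⟩
  have : (sSetTopAdj.homEquiv S Y) ((sSetTopAdj.homEquiv S Y).symm F) = F :=
    Equiv.apply_symm_apply _ _
  rw [Adjunction.homEquiv_unit] at this
  have h2 := congrArg (fun F : S ⟶ TopCat.toSSet.obj Y =>
    TopCat.toSSetObjEquiv Y _ (F.app (op ⦋n⦌) x) t) this
  rw [← unit_app_eq_cell]
  exact h2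

/-- The predicate of lying on a cell and the constant `True` are both continuous into an indiscrete
space of propositions. They agree on cells, hence everywhere by `realization_hom_ext`. -/
theorem exists_eq_cell (z : SSet.toTop.obj S) :
    ∃ (n : ℕ) (x : S _⦋n⦌) (t : _), z = cell x t := by
  let Y : TopCat.{u} := @TopCat.of (ULift.{u} Prop) ⊤
  let f : SSet.toTop.obj S ⟶ Y := @TopCat.ofHom _ _ _ ⊤
    (@ContinuousMap.mk _ _ _ ⊤ (fun z => ⟨∃ (n : ℕ) (x : S _⦋n⦌) (t : _), z = cell x t⟩)
      continuous_top)
  let g : SSet.toTop.obj S ⟶ Y := @TopCat.ofHom _ _ _ ⊤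
    (@ContinuousMap.mk _ _ _ ⊤ (fun _ => ⟨True⟩) continuous_top)
  have h : f = g := realization_hom_ext fun n x t =>
    congrArg ULift.up (eq_true ⟨n, x, t, rfl⟩)
  have h2 : ULift.up (∃ (n : ℕ) (x : S _⦋n⦌) (t : _), z = cell x t) = ULift.up True :=
    congrArg (fun f : SSet.toTop.obj S ⟶ Y => (f z : ULift Prop)) h
  exact of_eq_true (ULift.up_injective h2)

/-- Let `τ` be the final topology for the cells. The cells, seen as maps into `τ`, descend to a
continuous map out of the realization which is the identity on points, so `τ`-open sets are open. -/
theorem isOpen_iff_cell {U : Set (SSet.toTop.obj S)} :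
    IsOpen U ↔ ∀ (n : ℕ) (x : S _⦋n⦌), IsOpen (cell x ⁻¹' U) := by
  refine ⟨fun h n x => h.preimage (cell x).continuous, fun h => ?_⟩
  have continuous_hom : ∀ {Y : TopCat.{u}} (f : SSet.toTop.obj S ⟶ Y), Continuous f :=
    fun f => f.hom.continuous
  let τ : TopologicalSpace (SSet.toTop.obj S) :=
    ⨆ (n : ℕ) (x : S _⦋n⦌), TopologicalSpace.coinduced (cell x) inferInstance
  have hτ : ∀ (n : ℕ) (x : S _⦋n⦌), @Continuous _ _ _ τ (cell x) := fun n x =>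
    continuous_iff_coinduced_le.2
      (le_iSup_of_le n (le_iSup_of_le x le_rfl))
  let Y : TopCat.{u} := @TopCat.of (SSet.toTop.obj S) τ
  obtain ⟨f, hf⟩ := exists_realization_desc (S := S) (Y := Y)
    (fun n x => @ContinuousMap.mk _ _ _ τ (cell x) (hτ n x)) (fun α x t => cell_map α x t)
  have hf' : ∀ z, f z = z := by
    intro z
    obtain ⟨n, x, t, rfl⟩ := exists_eq_cell z
    exact hf n x t
  have hU : @IsOpen _ τ U := by
    simp only [τ, isOpen_iSup_iff, isOpen_coinduced]
    exact h
  convert @IsOpen.preimage _ _ (SSet.toTop.obj S).str τ _ (continuous_hom f) _ hU using 1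
  ext z
  exact iff_of_eq (congrArg (· ∈ U) (hf' z).symm)

theorem isClosed_iff_cell {C : Set (SSet.toTop.obj S)} :
    IsClosed C ↔ ∀ (n : ℕ) (x : S _⦋n⦌), IsClosed (cell x ⁻¹' C) := by
  simp only [← isOpen_compl_iff, isOpen_iff_cell, Set.preimage_compl]

theorem continuous_iff_cell {Y : Type*} [TopologicalSpace Y] {f : SSet.toTop.obj S → Y} :
    Continuous f ↔ ∀ (n : ℕ) (x : S _⦋n⦌), Continuous (f ∘ cell x) := by
  simp only [continuous_def, isOpen_iff_cell, Set.preimage_comp]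
  exact ⟨fun h n x s hs => h s hs n x, fun h s hs n x => h n x s hs⟩

end Realization

/-! ### Points of a simplex as step functions -/

section Level

/-- The partial sums `t₀ + ⋯ + tᵢ` of barycentric coordinates. -/
def cumul {n : ℕ} (t : stdSimplex ℝ (Fin (n + 1))) (i : Fin (n + 1)) : ℝ :=
  ∑ j with j ≤ i, t j

/-- A point `t` of the `n`-simplex cuts `[0, 1)` into consecutive intervals of lengths
`t₀, …, tₙ`; `level t s` is the index of the interval which contains `s`. -/
def level {n : ℕ} (t : stdSimplex ℝ (Fin (n + 1))) (s : ℝ) : Fin (n + 1) :=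
  (Finset.univ.filter fun i => s < cumul t i).inf id

variable {n : ℕ} (t : stdSimplex ℝ (Fin (n + 1)))

theorem cumul_mono : Monotone (cumul t) := fun i j h =>
  Finset.sum_le_sum_of_subset_of_nonneg
    (fun k hk => by simp only [Finset.mem_filter_univ] at hk ⊢; exact hk.trans h)
    fun k _ _ => stdSimplex.zero_le t k

theorem cumul_last : cumul t (Fin.last n) = 1 := by
  simp [cumul, Fin.le_last]

theorem cumul_nonneg (i : Fin (n + 1)) : 0 ≤ cumul t i :=
  Finset.sum_nonneg fun k _ => stdSimplex.zero_le t k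

theorem cumul_le_one (i : Fin (n + 1)) : cumul t i ≤ 1 :=
  (cumul_mono t (Fin.le_last i)).trans_eq (cumul_last t)

theorem continuous_cumul (i : Fin (n + 1)) :
    Continuous fun t : stdSimplex ℝ (Fin (n + 1)) => cumul t i :=
  continuous_finsetSum _ fun j _ => (continuous_apply j).comp continuous_subtype_val

theorem level_mono : Monotone (level t) := fun s s' h =>
  Finset.inf_mono fun i hi => by
    simp only [Finset.mem_filter_univ] at hi ⊢
    exact h.trans_lt hi

/-- For `s < 1` the infimum defining `level` runs over a nonempty set, as the last partial sum is
`1`; for `s ≥ 1` it would default to the last index. -/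
theorem level_le_iff {s : ℝ} (hs : s < 1) {i : Fin (n + 1)} :
    level t s ≤ i ↔ s < cumul t i := by
  constructor
  · intro h
    obtain ⟨j, hj, hj'⟩ := Finset.exists_mem_eq_inf
      (Finset.univ.filter fun i => s < cumul t i) ⟨Fin.last n, by simpa [cumul_last] using hs⟩ id
    rw [Finset.mem_filter_univ] at hj
    exact hj.trans_le (cumul_mono t (hj'.symm.trans_le h))
  · intro h
    exact Finset.inf_le (f := id) (by simpa using h)

theorem stdSimplex_map_apply {m : ℕ} (f : Fin (n + 1) → Fin (m + 1)) (i : Fin (m + 1)) :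
    stdSimplex.map f t i = ∑ j with f j = i, t j := by
  rw [stdSimplex.map_coe, FunOnFinite.linearMap_apply_apply]

theorem cumul_map {m : ℕ} (f : Fin (n + 1) → Fin (m + 1)) (i : Fin (m + 1)) :
    cumul (stdSimplex.map f t) i = ∑ j with f j ≤ i, t j := by
  simp only [cumul, stdSimplex_map_apply]
  rw [← Finset.sum_fiberwise_of_maps_to (s := Finset.univ.filter fun j => f j ≤ i)
    (t := Finset.univ.filter fun k => k ≤ i) (g := f) (by simp)]
  refine Finset.sum_congr rfl fun k hk => Finset.sum_congr ?_ fun _ _ => rfl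
  ext j
  rw [Finset.mem_filter_univ] at hk
  rw [Finset.mem_filter_univ, Finset.mem_filter, Finset.mem_filter_univ]
  constructor
  · rintro rfl
    exact ⟨hk, rfl⟩
  · exact fun h => h.2

/-- By monotonicity `{j | f j ≤ i}` is an initial segment, so partial sums of the image are partial
sums of `t`, or `0` when that set is empty; the latter case uses `0 ≤ s`. -/
theorem level_map {m : ℕ} {f : Fin (n + 1) → Fin (m + 1)} (hf : Monotone f) {s : ℝ}
    (hs : s ∈ Set.Ico (0 : ℝ) 1) :
    level (stdSimplex.map f t) s = f (level t s) := by
  refine eq_of_forall_ge_iff fun i => ?_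
  rw [level_le_iff _ hs.2, cumul_map]
  constructor
  · intro h
    by_contra hi
    refine h.not_ge ?_
    rcases (Finset.univ.filter fun j => f j ≤ i).eq_empty_or_nonempty with h0 | h0
    · rw [h0, Finset.sum_empty]
      exact hs.1
    · obtain ⟨j, hj, hmax⟩ := Finset.exists_max_image _ id h0
      rw [Finset.mem_filter_univ] at hj
      have : ¬ level t s ≤ j := fun h => hi ((hf h).trans hj)
      rw [level_le_iff t hs.2, not_lt] at this
      refine le_trans ?_ this
      exact Finset.sum_le_sum_of_subset_of_nonneg
        (fun k hk => by
          rw [Finset.mem_filter_univ]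
          exact hmax k hk)
        fun k _ _ => stdSimplex.zero_le t k
  · intro hi
    have := (level_le_iff t hs.2 (i := level t s)).1 le_rfl
    refine this.trans_le (Finset.sum_le_sum_of_subset_of_nonneg (fun k hk => ?_)
        fun k _ _ => stdSimplex.zero_le t k)
    rw [Finset.mem_filter_univ] at hk ⊢
    exact (hf hk).trans hi

/-- The left endpoint of the `k`-th interval serves, the interval being nonempty because `t k > 0`.
-/
theorem exists_level_eq {t : stdSimplex ℝ (Fin (n + 1))} (ht : ∀ i, 0 < t i) (k : Fin (n + 1)) :
    ∃ s ∈ Set.Ico (0 : ℝ) 1, level t s = k := by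
  have hlt : ∀ i, ∑ j with j < k, t j < cumul t i ↔ k ≤ i := by
    intro i
    constructor
    · intro h
      by_contra hi
      refine h.not_ge (Finset.sum_le_sum_of_subset_of_nonneg (fun j hj => ?_)
        fun k _ _ => stdSimplex.zero_le t k)
      rw [Finset.mem_filter_univ] at hj ⊢
      exact hj.trans_lt (not_le.1 hi)
    · intro h
      refine Finset.sum_lt_sum_of_subset (i := k) (fun j hj => ?_) (by simpa using h) (by simp)
        (ht k) fun k _ _ => stdSimplex.zero_le t k
      rw [Finset.mem_filter_univ] at hj ⊢
      exact hj.le.trans h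
  have h1 : ∑ j with j < k, t j < 1 := by
    rw [← cumul_last t]
    exact (hlt _).2 (Fin.le_last k)
  refine ⟨_, ⟨Finset.sum_nonneg fun k _ => stdSimplex.zero_le t k, h1⟩, ?_⟩
  refine eq_of_forall_ge_iff fun i => ?_
  rw [level_le_iff t h1, hlt]

theorem eq_of_cumul_eq {t t' : stdSimplex ℝ (Fin (n + 1))} (h : ∀ i, cumul t i = cumul t' i) :
    t = t' := by
  have key : ∀ (t : stdSimplex ℝ (Fin (n + 1))) (k), t k + ∑ j with j < k, t j = cumul t k := by
    intro t k
    have : (Finset.univ.filter fun j => j ≤ k) =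
        insert k (Finset.univ.filter fun j => j < k) := by
      ext j
      simp [le_iff_eq_or_lt]
    rw [cumul, this, Finset.sum_insert (by simp)]
  ext k
  induction k using WellFoundedLT.induction with
  | ind k ih =>
    have h1 := key t k
    have h2 := key t' k
    rw [Finset.sum_congr rfl fun j hj => ih j (by simpa using hj)] at h1
    linarith [h k]

/-- A telescoping sum. For increasing `e` the `k`-th term is the length of the part of `[e k, e (k +
1))` below `c`. -/
theorem sum_min_sub_min (N : ℕ) (e : Fin (N + 2) → ℝ) (c : ℝ) :
    ∑ k : Fin (N + 1), (min (e k.succ) c - min (e k.castSucc) c) =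
      min (e (Fin.last _)) c - min (e 0) c := by
  have := Finset.sum_range_sub (fun k => min (e (Fin.ofNat (N + 2) k)) c) (N + 1)
  rw [Finset.sum_range] at this
  have hlast : Fin.ofNat (N + 2) (N + 1) = Fin.last _ := by ext; simp
  have h0 : Fin.ofNat (N + 2) 0 = 0 := rfl
  rw [hlast, h0] at this
  rw [← this]
  refine Finset.sum_congr rfl fun k _ => ?_
  have h1 : Fin.ofNat (N + 2) (k + 1) = k.succ := by
    ext
    simp [k.is_le]
  have h2 : Fin.ofNat (N + 2) k = k.castSucc := by
    ext
    simp
  rw [h1, h2]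

/-- Finitely many points of simplices are images of a common interior point of one simplex under
monotone maps. -/
theorem exists_common_refinement {ι : Type*} [Fintype ι] (n : ι → ℕ)
    (t : ∀ i, stdSimplex ℝ (Fin (n i + 1))) :
    ∃ N ≤ ∑ i, n i, ∃ s : stdSimplex ℝ (Fin (N + 1)), (∀ k, 0 < s k) ∧
      ∃ α : ∀ i, Fin (N + 1) →o Fin (n i + 1), ∀ i, stdSimplex.map (α i) s = t i := by
  classical
  -- Cut `[0, 1)` at all partial sums of all the `t i`. The last partial sum is always `1` and is
  -- omitted from `Q`, so each `i` contributes at most `n i` cuts.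
  let Q : Finset ℝ := Finset.univ.biUnion fun i =>
    Finset.univ.image fun j : Fin (n i) => cumul (t i) j.castSucc
  let P : Finset ℝ := insert 0 (insert 1 Q)
  have hP0 : (0 : ℝ) ∈ P := by simp [P]
  have hP1 : (1 : ℝ) ∈ P := by simp [P]
  have hPQ : ∀ i j, cumul (t i) j ∈ P := by
    intro i j
    induction j using Fin.lastCases with
    | last => rw [cumul_last]; exact hP1
    | cast j =>
      simp only [P, Q, Finset.mem_insert, Finset.mem_biUnion, Finset.mem_image]
      exact Or.inr (Or.inr ⟨i, Finset.mem_univ _, j, Finset.mem_univ _, rfl⟩)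
  have hPle : ∀ x ∈ P, 0 ≤ x ∧ x ≤ 1 := by
    intro x hx
    simp only [P, Q, Finset.mem_insert, Finset.mem_biUnion, Finset.mem_image] at hx
    rcases hx with rfl | rfl | ⟨i, -, j, -, rfl⟩
    · simp
    · simp
    · exact ⟨cumul_nonneg _ _, cumul_le_one _ _⟩
  have hcardQ : Q.card ≤ ∑ i, n i := by
    refine Finset.card_biUnion_le.trans (Finset.sum_le_sum fun i _ => ?_)
    exact Finset.card_image_le.trans (by simp)
  have hcard : 2 ≤ P.card := by
    have : ({0, 1} : Finset ℝ) ⊆ P := by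
      intro x hx
      simp only [Finset.mem_insert, Finset.mem_singleton] at hx
      rcases hx with rfl | rfl <;> assumption
    simpa using Finset.card_le_card this
  obtain ⟨N, hN⟩ := Nat.exists_eq_add_of_le' hcard
  have hNle : N ≤ ∑ i, n i := by
    have h1 := Finset.card_insert_le (0 : ℝ) (insert 1 Q)
    have h2 := Finset.card_insert_le (1 : ℝ) Q
    have : P.card = (insert (0 : ℝ) (insert 1 Q)).card := rfl
    omega
  let e : Fin (N + 2) ↪o ℝ := P.orderEmbOfFin hN
  have he : ∀ x, x ∈ P ↔ ∃ k, e k = x := by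
    intro x
    have := Finset.range_orderEmbOfFin P hN
    rw [← Finset.mem_coe, ← this]
    rfl
  have heP : ∀ k, e k ∈ P := fun k => (he _).2 ⟨k, rfl⟩
  have he0 : e 0 = 0 := by
    obtain ⟨k, hk⟩ := (he 0).1 hP0
    exact le_antisymm ((e.monotone (Fin.zero_le k)).trans_eq hk) (hPle _ (heP 0)).1
  have he1 : e (Fin.last _) = 1 := by
    obtain ⟨k, hk⟩ := (he 1).1 hP1
    exact le_antisymm (hPle _ (heP _)).2 (hk.symm.trans_le (e.monotone (Fin.le_last k)))
  have hpos : ∀ k : Fin (N + 1), 0 < e k.succ - e k.castSucc := fun k =>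
    sub_pos.2 (e.strictMono Fin.castSucc_lt_succ)
  -- As `c` is itself a cut point, every interval lies entirely below or entirely above it.
  have hsum : ∀ c ∈ P, ∑ k with e (Fin.castSucc k) < c, (e k.succ - e k.castSucc) = c := by
    intro c hc
    have := sum_min_sub_min N e c
    rw [he0, he1, min_eq_right (hPle c hc).2, min_eq_left (hPle c hc).1, sub_zero] at this
    rw [Finset.sum_filter]
    refine (Finset.sum_congr rfl fun k _ => ?_).trans this
    obtain ⟨m, rfl⟩ := (he c).1 hc
    split_ifs with h
    · rw [min_eq_left h.le, min_eq_left (e.monotone ?_)]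
      have := e.lt_iff_lt.1 h
      exact Fin.castSucc_lt_iff_succ_le.1 this
    · have h' := not_lt.1 h
      rw [min_eq_right h', min_eq_right (h'.trans (sub_pos.1 (hpos k)).le), sub_self]
  let s : stdSimplex ℝ (Fin (N + 1)) := ⟨fun k => e k.succ - e k.castSucc,
    fun k => (hpos k).le, by
      have := hsum 1 hP1
      rwa [Finset.filter_true_of_mem] at this
      intro k _
      rw [← he1]
      exact e.strictMono (Fin.castSucc_lt_last k)⟩
  -- No interval of the refinement is cut by a partial sum of `t i`, so the level at its left
  -- endpoint is the level throughout.
  refine ⟨N, hNle, s, hpos, fun i => ⟨fun k => level (t i) (e k.castSucc), fun k k' h =>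
    level_mono _ (e.monotone (Fin.castSucc_le_castSucc_iff.2 h))⟩, fun i => ?_⟩
  refine eq_of_cumul_eq fun j => ?_
  rw [cumul_map]
  refine Eq.trans ?_ (hsum _ (hPQ i j))
  refine Finset.sum_congr (Finset.filter_congr fun k _ => ?_) fun _ _ => rfl
  refine level_le_iff _ ?_
  rw [← he1]
  exact e.strictMono (Fin.castSucc_lt_last k)

end Level

/-! ### Classifying spaces as spaces of step functions -/

section Holonomy

open CategoryTheory Simplicial Opposite

variable {G G₁ : Type u} [Group G] [Group G₁] {n : ℕ}

/-- The label of the edge from the vertex `0` to the vertex `i` of a simplex of the nerve of a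
group. -/
def hol (x : (nerve (SingleObj G)) _⦋n⦌) (i : Fin (n + 1)) : G :=
  CategoryTheory.Functor.map (C := Fin (n + 1)) (D := SingleObj G) x (homOfLE (Fin.zero_le i))

theorem map_mul_hol (x : (nerve (SingleObj G)) _⦋n⦌) {i j : Fin (n + 1)} (h : i ⟶ j) :
    (CategoryTheory.Functor.map (C := Fin (n + 1)) (D := SingleObj G) x h : G) * hol x i = hol x j := by
  have := CategoryTheory.Functor.map_comp (C := Fin (n + 1)) (D := SingleObj G) x (homOfLE (Fin.zero_le i)) h
  exact this.symm

theorem map_eq_hol (x : (nerve (SingleObj G)) _⦋n⦌) {i j : Fin (n + 1)} (h : i ⟶ j) :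
    (CategoryTheory.Functor.map (C := Fin (n + 1)) (D := SingleObj G) x h : G) = hol x j * (hol x i)⁻¹ :=
  eq_mul_inv_of_mul_eq (map_mul_hol x h)

/-- The label of the edge from `i` to `j` is recovered as `hol x j * (hol x i)⁻¹`. -/
theorem hol_injective : Function.Injective (hol (G := G) (n := n)) := by
  intro x y h
  refine Functor.hext (C := Fin (n + 1)) (D := SingleObj G) (fun _ => rfl) fun i j f => ?_
  refine heq_of_eq ((map_eq_hol x f).trans (Eq.trans ?_ (map_eq_hol y f).symm))
  rw [h]

instance finite_nerve [Finite G] : Finite ((nerve (SingleObj G)) _⦋n⦌) :=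
  Finite.of_injective _ hol_injective

theorem hol_map {m : ℕ} (α : (⦋m⦌ : SimplexCategory) ⟶ ⦋n⦌) (x : (nerve (SingleObj G)) _⦋n⦌)
    (i : Fin (m + 1)) :
    hol ((nerve (SingleObj G)).map α.op x) i = hol x (α i) * (hol x (α 0))⁻¹ :=
  map_eq_hol x _

theorem hol_nerveMap (f : G →* G₁) (x : (nerve (SingleObj G)) _⦋n⦌) (i : Fin (n + 1)) :
    hol ((nerveMap f.toFunctor).app (op ⦋n⦌) x) i = f (hol x i) :=
  rfl

/-- With an indiscrete target, only compatibility with simplicial operators has to be checked.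
Dividing by the label at `level t 0` cancels the change of initial vertex in `hol_map`. The value
`1` outside `[0, 1)` is a convention. -/
theorem exists_stepFun (G : Type u) [Group G] : ∃ φ : BSpace G → ℝ → G,
    ∀ (n : ℕ) (x : (nerve (SingleObj G)) _⦋n⦌) (t) (s : ℝ),
      φ (cell x t) s = if s ∈ Set.Ico (0 : ℝ) 1 then
        hol x (level t s) * (hol x (level t 0))⁻¹ else 1 := by
  classical
  let Y : TopCat.{u} := @TopCat.of (ℝ → G) ⊤
  obtain ⟨f, hf⟩ := exists_realization_desc (S := nerve (SingleObj G)) (Y := Y)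
    (fun n x => @ContinuousMap.mk _ _ _ ⊤ (fun t s => if s ∈ Set.Ico (0 : ℝ) 1 then
        hol x (level t s) * (hol x (level t 0))⁻¹ else 1) continuous_top) (by
      intro m n α x t
      funext s
      change (if _ then _ else _) = (if _ then _ else _)
      split_ifs with hs
      · have hα : Monotone α := α.toOrderHom.monotone
        rw [level_map _ hα hs, level_map _ hα ⟨le_rfl, zero_lt_one⟩, hol_map, hol_map]
        group
      · rfl)
  exact ⟨f, fun n x t s => congrFun (hf n x t) s⟩

/-- The step function `[0, 1) → G` attached to a point of `BG`, with value `1` at `0`: on the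
point with barycentric coordinates `t` of a simplex of the nerve it is the path of labels read off
along the intervals of lengths `t₀, …, tₙ`. -/
def stepFun (z : BSpace G) : ℝ → G := (exists_stepFun G).choose z

theorem stepFun_cell (x : (nerve (SingleObj G)) _⦋n⦌) (t) {s : ℝ} (hs : s ∈ Set.Ico (0 : ℝ) 1) :
    stepFun (G := G) (cell x t) s = hol x (level t s) * (hol x (level t 0))⁻¹ :=
  ((exists_stepFun G).choose_spec n x t s).trans (if_pos hs)

theorem stepFun_of_notMem (z : BSpace G) {s : ℝ} (hs : s ∉ Set.Ico (0 : ℝ) 1) :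
    stepFun z s = 1 := by
  obtain ⟨n, x, t, rfl⟩ := exists_eq_cell z
  exact ((exists_stepFun G).choose_spec n x t s).trans (if_neg hs)

theorem stepFun_zero (z : BSpace G) : stepFun z 0 = 1 := by
  obtain ⟨n, x, t, rfl⟩ := exists_eq_cell z
  exact (stepFun_cell x t ⟨le_rfl, zero_lt_one⟩).trans (mul_inv_cancel _)

theorem BMap_cell (f : G →* G₁) (x : (nerve (SingleObj G)) _⦋n⦌) (t) :
    BMap f (cell x t) = cell ((nerveMap f.toFunctor).app (op ⦋n⦌) x) t :=
  map_cell _ x t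

theorem stepFun_BMap (f : G →* G₁) (z : BSpace G) (s : ℝ) :
    stepFun (BMap f z) s = f (stepFun z s) := by
  by_cases hs : s ∈ Set.Ico (0 : ℝ) 1
  · obtain ⟨n, x, t, rfl⟩ := exists_eq_cell z
    have h1 := stepFun_cell ((nerveMap f.toFunctor).app (op ⦋n⦌) x) t hs
    rw [hol_nerveMap, hol_nerveMap] at h1
    refine (congrArg (fun z => stepFun z s) (BMap_cell f x t)).trans (h1.trans ?_)
    refine Eq.trans ?_ (congrArg f (stepFun_cell x t hs)).symm
    rw [map_mul, map_inv]
  · rw [stepFun_of_notMem _ hs, stepFun_of_notMem _ hs, map_one]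

/-- Two simplices of the nerve of a group with the same step function at one interior point are
equal. -/
theorem eq_of_stepFun_cell_eq {x y : (nerve (SingleObj G)) _⦋n⦌} {t} (ht : ∀ i, 0 < t i)
    (h : stepFun (G := G) (cell x t) = stepFun (G := G) (cell y t)) : x = y := by
  have hol0 : ∀ x : (nerve (SingleObj G)) _⦋n⦌, hol x 0 = 1 := fun x =>
    CategoryTheory.Functor.map_id (C := Fin (n + 1)) (D := SingleObj G) x 0
  have hl : level t 0 = 0 := by
    rw [← Fin.le_zero_iff, level_le_iff t zero_lt_one]
    exact Finset.sum_pos (fun i _ => ht i) ⟨0, by simp⟩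
  apply hol_injective
  funext k
  obtain ⟨s, hs, rfl⟩ := exists_level_eq ht k
  have := congrFun h s
  rwa [stepFun_cell x t hs, stepFun_cell y t hs, hl, hol0, hol0, inv_one, mul_one, mul_one] at this

/-- A common refinement puts both points at the same interior point `s` of two simplices of equal
dimension; there the step function determines the simplex. -/
theorem stepFun_injective : Function.Injective (stepFun (G := G)) := by
  intro z w h
  obtain ⟨n, x, t, rfl⟩ := exists_eq_cell z
  obtain ⟨m, y, t', rfl⟩ := exists_eq_cell w
  obtain ⟨N, -, s, hs, α, hα⟩ := exists_common_refinement (ι := Bool)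
    (fun b => Bool.rec m n b) (fun b => Bool.rec t' t b)
  have h1 := cell_map (SimplexCategory.Hom.mk (a := ⦋N⦌) (b := ⦋n⦌) (α true)) x s
  have h2 := cell_map (SimplexCategory.Hom.mk (a := ⦋N⦌) (b := ⦋m⦌) (α false)) y s
  have e1 : stdSimplex.map (α true) s = t := hα true
  have e2 : stdSimplex.map (α false) s = t' := hα false
  replace h1 := h1.trans (congrArg (cell x) e1)
  replace h2 := h2.trans (congrArg (cell y) e2)
  have h3 := h
  rw [← h1, ← h2] at h3 ⊢
  rw [eq_of_stepFun_cell_eq hs h3]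

theorem basePoint_eq_cell :
    basePoint G = cell (S := nerve (SingleObj G)) (n := 0) (nerveEquiv.symm (SingleObj.star G))
      default :=
  rfl

theorem stepFun_basePoint (s : ℝ) : stepFun (basePoint G) s = 1 := by
  by_cases hs : s ∈ Set.Ico (0 : ℝ) 1
  · rw [basePoint_eq_cell]
    refine (stepFun_cell _ _ hs).trans ?_
    rw [Subsingleton.elim (α := Fin 1) (level default s) (level default 0), mul_inv_cancel]
  · exact stepFun_of_notMem _ hs

end Holonomy

/-! ### Classifying spaces are Hausdorff -/

section Hausdorff

open CategoryTheory Simplicial Opposite MeasureTheory Filter Topology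

variable {n : ℕ}

theorem measurable_level (t : stdSimplex ℝ (Fin (n + 1))) : Measurable (level t) :=
  (level_mono t).measurable

/-- The level of a point which is not a partial sum is locally constant in the point of the
simplex. -/
theorem eventually_level_eq {t : stdSimplex ℝ (Fin (n + 1))} {s : ℝ} (hs : s < 1)
    (h : ∀ i, s ≠ cumul t i) : ∀ᶠ t' in 𝓝 t, level t' s = level t s := by
  have : ∀ i, ∀ᶠ t' in 𝓝 t, (s < cumul t' i ↔ s < cumul t i) := by
    intro i
    rcases lt_or_gt_of_ne (h i) with hi | hi
    · filter_upwards [(continuous_cumul i).continuousAt.eventually (lt_mem_nhds hi)] with t' ht'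
      exact iff_of_true ht' hi
    · filter_upwards [(continuous_cumul i).continuousAt.eventually (gt_mem_nhds hi)] with t' ht'
      exact iff_of_false ht'.not_gt hi.not_gt
  filter_upwards [eventually_all.2 this] with t' ht'
  refine eq_of_forall_ge_iff fun i => ?_
  rw [level_le_iff _ hs, level_le_iff _ hs, ht']

theorem ae_ne_cumul (t : stdSimplex ℝ (Fin (n + 1))) (r : ℝ) :
    ∀ᵐ ε : ℝ, ∀ i, r + ε ≠ cumul t i := by
  refine ae_all_iff.2 fun i => ?_
  filter_upwards [Measure.ae_ne volume (cumul t i - r)] with ε hε h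
  exact hε (by linarith)

/-- Dominated convergence: for all but finitely many `ε` neither `r + ε` nor `ε` is a partial sum of
`t₀`, and then the integrand is locally constant at `t₀`. -/
theorem continuous_integral_level (v : Fin (n + 1) → Fin (n + 1) → ℝ) {r δ : ℝ} (hr : 0 ≤ r)
    (hδ : r + δ ≤ 1) :
    Continuous fun t : stdSimplex ℝ (Fin (n + 1)) =>
      ∫ ε in Set.Ico 0 δ, v (level t (r + ε)) (level t ε) := by
  refine continuous_iff_continuousAt.2 fun t₀ => ?_
  refine continuousAt_of_dominated (bound := fun _ => ∑ i, ∑ j, |v i j|) ?_ ?_ ?_ ?_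
  · refine Eventually.of_forall fun t => Measurable.aestronglyMeasurable ?_
    have h1 : Measurable fun ε : ℝ => (level t (r + ε), level t ε) :=
      ((measurable_level t).comp (measurable_const_add r)).prodMk (measurable_level t)
    exact (measurable_of_finite (fun p : Fin (n + 1) × Fin (n + 1) => v p.1 p.2)).comp h1
  · refine Eventually.of_forall fun t => Eventually.of_forall fun ε => ?_
    refine le_trans ?_ (Finset.single_le_sum (f := fun i => ∑ j, |v i j|)
      (fun i _ => Finset.sum_nonneg fun j _ => abs_nonneg _) (Finset.mem_univ (level t (r + ε))))
    exact Finset.single_le_sum (f := fun j => |v (level t (r + ε)) j|)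
      (fun j _ => abs_nonneg _) (Finset.mem_univ (level t ε))
  · exact integrable_const _
  · rw [ae_restrict_iff' measurableSet_Ico]
    filter_upwards [ae_ne_cumul t₀ r, ae_ne_cumul t₀ 0] with ε h1 h2 hε
    have e1 := eventually_level_eq (by linarith [hε.2]) h1
    have e2 := eventually_level_eq (by linarith [hε.2]) h2
    rw [zero_add] at e2
    refine continuousAt_const.congr (f := fun _ => v (level t₀ (r + ε)) (level t₀ ε)) ?_
    filter_upwards [e1, e2] with t h1 h2
    rw [h1, h2]

/-- Levels are right continuous. -/
theorem exists_level_right_const (t : stdSimplex ℝ (Fin (n + 1))) {r : ℝ} (hr : r < 1) :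
    ∀ᶠ ε in 𝓝[≥] (0 : ℝ), level t (r + ε) = level t r := by
  have hlt : ∀ c, r < c → ∀ᶠ ε in 𝓝[≥] (0 : ℝ), r + ε < c := fun c hc => by
    filter_upwards [mem_nhdsWithin_of_mem_nhds (gt_mem_nhds (sub_pos.2 hc))] with ε hε
    linarith
  have : ∀ i, ∀ᶠ ε in 𝓝[≥] (0 : ℝ), (r + ε < cumul t i ↔ r < cumul t i) := by
    intro i
    by_cases hi : r < cumul t i
    · filter_upwards [hlt _ hi] with ε hε
      exact iff_of_true hε hi
    · filter_upwards [self_mem_nhdsWithin] with ε hε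
      have hε' : (0 : ℝ) ≤ ε := hε
      exact iff_of_false (by linarith [not_lt.1 hi]) hi
  filter_upwards [eventually_all.2 this, hlt 1 hr] with ε h h1
  refine eq_of_forall_ge_iff fun i => ?_
  rw [level_le_iff _ h1, level_le_iff _ hr, h]

variable {G : Type u} [Group G]

theorem eventually_stepFun_add (z : BSpace G) {r : ℝ} (hr : r ∈ Set.Ico (0 : ℝ) 1) :
    ∀ᶠ ε in 𝓝[≥] (0 : ℝ), stepFun z (r + ε) = stepFun z r := by
  obtain ⟨n, x, t, rfl⟩ := exists_eq_cell z
  have h1 : ∀ᶠ ε in 𝓝[≥] (0 : ℝ), ε < 1 - r :=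
    mem_nhdsWithin_of_mem_nhds (gt_mem_nhds (sub_pos.2 hr.2))
  filter_upwards [exists_level_right_const t hr.2, h1, self_mem_nhdsWithin] with ε h h1 h2
  have h2' : (0 : ℝ) ≤ ε := h2
  have h3 : r + ε ∈ Set.Ico (0 : ℝ) 1 := ⟨add_nonneg hr.1 h2, by linarith⟩
  exact (stepFun_cell x t h3).trans
    ((congrArg (fun k => hol x k * (hol x (level t 0))⁻¹) h).trans (stepFun_cell x t hr).symm)

-- Values of `stepFun` at a fixed time jump; averaging over `ε` smooths this. The quotient by
-- `stepFun z ε` removes the normalizing factor at `level t 0`, which itself jumps when initial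
-- coordinates vanish.
open Classical in
theorem continuous_integral_stepFun (g : G) {r δ : ℝ} (hr : 0 ≤ r) (hδ : r + δ ≤ 1) :
    Continuous fun z : BSpace G =>
      ∫ ε in Set.Ico 0 δ, if stepFun z (r + ε) * (stepFun z ε)⁻¹ = g then (1 : ℝ) else 0 := by
  refine continuous_iff_cell.2 fun n x => ?_
  refine (continuous_integral_level
    (fun i j => if hol x i * (hol x j)⁻¹ = g then (1 : ℝ) else 0) hr hδ).congr fun t => ?_
  refine setIntegral_congr_fun measurableSet_Ico fun ε hε => ?_
  have h1 := stepFun_cell x t (s := r + ε) ⟨by linarith [hε.1], by linarith [hε.2]⟩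
  have h2 := stepFun_cell x t (s := ε) ⟨by linarith [hε.1], by linarith [hε.2]⟩
  have : stepFun (G := G) (cell x t) (r + ε) * (stepFun (G := G) (cell x t) ε)⁻¹ =
      hol x (level t (r + ε)) * (hol x (level t ε))⁻¹ := by
    rw [h1, h2]
    group
  change _ = if stepFun (G := G) (cell x t) (r + ε) * (stepFun (G := G) (cell x t) ε)⁻¹ = g
    then (1 : ℝ) else 0
  rw [this]

instance t2Space_BSpace : T2Space (BSpace G) := by
  classical
  refine ⟨fun z w hzw => ?_⟩
  obtain ⟨r, hr⟩ := Function.ne_iff.1 (stepFun_injective.ne hzw)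
  have hr01 : r ∈ Set.Ico (0 : ℝ) 1 := by
    by_contra h
    exact hr (by rw [stepFun_of_notMem _ h, stepFun_of_notMem _ h])
  have h0 : (0 : ℝ) ∈ Set.Ico (0 : ℝ) 1 := ⟨le_rfl, zero_lt_one⟩
  have hev : ∀ z : BSpace G, ∀ᶠ ε in 𝓝[≥] (0 : ℝ),
      stepFun z (r + ε) * (stepFun z ε)⁻¹ = stepFun z r := fun z => by
    filter_upwards [eventually_stepFun_add z hr01, eventually_stepFun_add z h0] with ε h1 h2
    rw [zero_add] at h2
    rw [h1, h2, stepFun_zero, inv_one, mul_one]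
  have hlt : ∀ᶠ ε in 𝓝[≥] (0 : ℝ), ε < 1 - r :=
    mem_nhdsWithin_of_mem_nhds (gt_mem_nhds (sub_pos.2 hr01.2))
  -- On `[0, δ)` both quotients keep their values at `ε = 0`, so the integral for `g = stepFun z r`
  -- is `δ` at `z` and `0` at `w`.
  obtain ⟨δ, hδ, hall⟩ := (mem_nhdsGE_iff_exists_Ico_subset' (zero_lt_one' ℝ)).1
    ((hev z).and ((hev w).and hlt))
  have hδ' : (0 : ℝ) < δ := hδ
  have hδ1 : r + δ ≤ 1 := by
    by_contra h
    have := (hall (a := max 0 (1 - r)) ⟨le_max_left _ _, max_lt hδ' (by linarith)⟩).2.2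
    exact this.not_ge (le_max_right _ _)
  refine separated_by_continuous (continuous_integral_stepFun (stepFun z r) hr01.1 hδ1) ?_
  have hz : ∫ ε in Set.Ico 0 δ, (if stepFun z (r + ε) * (stepFun z ε)⁻¹ = stepFun z r
      then (1 : ℝ) else 0) = δ := by
    rw [setIntegral_congr_fun (g := fun _ => (1 : ℝ)) measurableSet_Ico
      fun ε hε => if_pos (hall hε).1]
    simp [hδ'.le]
  have hw : ∫ ε in Set.Ico 0 δ, (if stepFun w (r + ε) * (stepFun w ε)⁻¹ = stepFun z r
      then (1 : ℝ) else 0) = 0 := by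
    rw [setIntegral_congr_fun (g := fun _ => (0 : ℝ)) measurableSet_Ico
      fun ε hε => if_neg fun h => hr (h.symm.trans (hall hε).2.1)]
    simp
  rw [hz, hw]
  exact hδ'.ne'

end Hausdorff

/-! ### Finite products of spaces with a compact exhaustion -/

section Exhaustion

open Set Topology

/-- A space is coherent with an increasing sequence `K` of compact subsets that cover it. -/
structure IsCompactFiltration {X : Type*} [TopologicalSpace X] (K : ℕ → Set X) : Prop where
  mono : Monotone K
  isCompact : ∀ k, IsCompact (K k)
  exists_mem : ∀ x, ∃ k, x ∈ K k
  isClosed_of_inter : ∀ C : Set X, (∀ k, IsClosed (C ∩ K k)) → IsClosed C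

theorem IsCompactFiltration.isOpen_of_inter {X : Type*} [TopologicalSpace X] [T2Space X] {K : ℕ → Set X}
    (hK : IsCompactFiltration K) {U : Set X}
    (hU : ∀ k, ∃ V, IsOpen V ∧ U ∩ K k = V ∩ K k) : IsOpen U := by
  rw [← isClosed_compl_iff]
  refine hK.isClosed_of_inter _ fun k => ?_
  obtain ⟨V, hV, h⟩ := hU k
  have : Uᶜ ∩ K k = Vᶜ ∩ K k := by
    ext x
    have := congrArg (x ∈ ·) h
    simp only [mem_inter_iff, mem_compl_iff, eq_iff_iff] at this ⊢
    tauto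
  rw [this]
  exact hV.isClosed_compl.inter (hK.isCompact k).isClosed

variable {ι : Type*} [Finite ι] {X : ι → Type*} [∀ i, TopologicalSpace (X i)] [∀ i, T2Space (X i)]

/-- A compact box contained in an open set of a finite product can be thickened, inside a larger
compact box, to a compact box contained in the same open set. -/
theorem exists_compact_box {A K : ∀ i, Set (X i)} (hA : ∀ i, IsCompact (A i))
    (hK : ∀ i, IsCompact (K i)) (hAK : ∀ i, A i ⊆ K i) {O : Set (∀ i, X i)} (hO : IsOpen O)
    (h : univ.pi A ⊆ O) :
    ∃ B V : ∀ i, Set (X i), (∀ i, IsCompact (B i)) ∧ (∀ i, B i ⊆ K i) ∧ univ.pi B ⊆ O ∧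
      ∀ i, IsOpen (V i) ∧ A i ⊆ V i ∧ V i ∩ K i ⊆ B i := by
  classical
  have := Fintype.ofFinite ι
  suffices H : ∀ s : Finset ι, ∃ B : ∀ i, Set (X i), (∀ i ∉ s, B i = A i) ∧
      (∀ i, IsCompact (B i)) ∧ (∀ i, B i ⊆ K i) ∧ univ.pi B ⊆ O ∧
      ∀ i ∈ s, ∃ V, IsOpen V ∧ A i ⊆ V ∧ V ∩ K i ⊆ B i by
    obtain ⟨B, -, h1, h2, h3, h4⟩ := H Finset.univ
    choose V hV using fun i => h4 i (Finset.mem_univ i)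
    exact ⟨B, V, h1, h2, h3, hV⟩
  intro s
  induction s using Finset.induction_on with
  | empty => exact ⟨A, fun _ _ => rfl, hA, hAK, h, by simp⟩
  | insert i s hi ih =>
    obtain ⟨B, hBA, hB, hBK, hBO, hBs⟩ := ih
    -- Widen the `i`-th side to all of `K i`. The part escaping `O` is compact, and its `i`-th
    -- projection misses `A i`, so an open `V'` around that projection can be removed from `K i`.
    have hC : IsCompact (univ.pi (Function.update B i (K i)) \ O) := by
      refine (isCompact_univ_pi fun j => ?_).diff hO
      rcases eq_or_ne j i with rfl | hj
      · simpa using hK j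
      · simpa [hj] using hB j
    have hdisj : Disjoint (A i) (Function.eval i '' (univ.pi (Function.update B i (K i)) \ O)) := by
      rw [disjoint_left]
      rintro _ ha ⟨z, ⟨hz, hzO⟩, rfl⟩
      refine hzO (hBO fun j _ => ?_)
      rcases eq_or_ne j i with rfl | hj
      · rw [hBA j hi]
        exact ha
      · simpa [hj] using hz j (mem_univ j)
    obtain ⟨V, V', hV, hV', hAV, hCV', hVV'⟩ :=
      SeparatedNhds.of_isCompact_isCompact (hA i) (hC.image (continuous_apply i)) hdisj
    refine ⟨Function.update B i (K i \ V'), ?_, ?_, ?_, ?_, ?_⟩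
    · intro j hj
      rw [Finset.mem_insert, not_or] at hj
      rw [Function.update_of_ne hj.1, hBA j hj.2]
    · intro j
      rcases eq_or_ne j i with rfl | hj
      · simpa using (hK j).diff hV'
      · simpa [hj] using hB j
    · intro j
      rcases eq_or_ne j i with rfl | hj
      · simp
      · simpa [hj] using hBK j
    · intro z hz
      by_contra hzO
      have hzi := hz i (mem_univ i)
      rw [Function.update_self] at hzi
      refine hzi.2 (hCV' ⟨z, ⟨fun j _ => ?_, hzO⟩, rfl⟩)
      rcases eq_or_ne j i with rfl | hj
      · simpa using hzi.1
      · simpa [hj] using hz j (mem_univ j)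
    · intro j hj
      rcases eq_or_ne j i with rfl | hji
      · rw [Function.update_self]
        exact ⟨V, hV, hAV, fun x hx => ⟨hx.2, disjoint_left.1 hVV' hx.1⟩⟩
      · rw [Function.update_of_ne hji]
        exact hBs j ((Finset.mem_insert.1 hj).resolve_left hji)

/-- A finite product of Hausdorff spaces with compact filtrations is coherent with the products of
the stages. -/
theorem isOpen_pi_of_isCompactFiltration {K : ∀ i, ℕ → Set (X i)}
    (hK : ∀ i, IsCompactFiltration (K i)) {W : Set (∀ i, X i)}
    (hW : ∀ k, ∃ O, IsOpen O ∧ W ∩ univ.pi (fun i => K i k) = O ∩ univ.pi (fun i => K i k)) :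
    IsOpen W := by
  classical
  have := Fintype.ofFinite ι
  rw [isOpen_iff_mem_nhds]
  intro x hx
  obtain ⟨k₀, hk₀⟩ : ∃ k₀, ∀ i, x i ∈ K i k₀ := by
    choose k hk using fun i => (hK i).exists_mem (x i)
    exact ⟨Finset.univ.sup k, fun i => (hK i).mono (Finset.le_sup (Finset.mem_univ i)) (hk i)⟩
  have step : ∀ (m : ℕ) (B : {B : ∀ i, Set (X i) //
      (∀ i, IsCompact (B i)) ∧ (∀ i, B i ⊆ K i (k₀ + m)) ∧ univ.pi B ⊆ W}),
      ∃ B' : {B : ∀ i, Set (X i) //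
        (∀ i, IsCompact (B i)) ∧ (∀ i, B i ⊆ K i (k₀ + (m + 1))) ∧ univ.pi B ⊆ W},
        ∃ V : ∀ i, Set (X i), ∀ i, IsOpen (V i) ∧ B.1 i ⊆ V i ∧
          V i ∩ K i (k₀ + (m + 1)) ⊆ B'.1 i := by
    rintro m ⟨B, hB, hBK, hBW⟩
    obtain ⟨O, hO, hOW⟩ := hW (k₀ + (m + 1))
    have hBK' : ∀ i, B i ⊆ K i (k₀ + (m + 1)) := fun i =>
      (hBK i).trans ((hK i).mono (by omega))
    obtain ⟨B', V, h1, h2, h3, h4⟩ := exists_compact_box hB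
      (fun i => (hK i).isCompact (k₀ + (m + 1))) hBK' hO
      fun z hz => (hOW.subset ⟨hBW hz, fun i hi => hBK' i (hz i hi)⟩).1
    exact ⟨⟨B', h1, h2, fun z hz => (hOW.superset ⟨h3 hz, fun i hi => h2 i (hz i hi)⟩).1⟩, V, h4⟩
  choose next V hV using step
  -- Starting from `{x}`, each box is a neighbourhood of its predecessor relative to the next stage.
  -- The unions of the sides over `m` will be open and their product stays in `W`.
  let B : ∀ m : ℕ, {B : ∀ i, Set (X i) //
      (∀ i, IsCompact (B i)) ∧ (∀ i, B i ⊆ K i (k₀ + m)) ∧ univ.pi B ⊆ W} := fun m =>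
    Nat.rec ⟨fun i => {x i}, fun i => isCompact_singleton, fun i => by simpa using hk₀ i, by
      simpa [univ_pi_singleton] using hx⟩ (fun m B => next m B) m
  have hBV : ∀ m i, IsOpen (V m (B m) i) ∧ (B m).1 i ⊆ V m (B m) i ∧
      V m (B m) i ∩ K i (k₀ + (m + 1)) ⊆ (B (m + 1)).1 i := fun m i => hV m (B m) i
  have hBmono : ∀ i, Monotone fun m => (B m).1 i := fun i => monotone_nat_of_le_succ fun m z hz =>
    (hBV m i).2.2 ⟨(hBV m i).2.1 hz, (hK i).mono (by omega) ((B m).2.2.1 i hz)⟩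
  have hUopen : ∀ i, IsOpen (⋃ m, (B m).1 i) := by
    -- For `m ≥ k` the stage `k₀ + (m + 1)` contains `K i k`, so there `V m (B m) i` lies inside the
    -- next box.
    refine fun i => (hK i).isOpen_of_inter fun k => ⟨⋃ m ≥ k, V m (B m) i,
      isOpen_biUnion fun m _ => (hBV m i).1, ?_⟩
    ext z
    simp only [mem_inter_iff, mem_iUnion, exists_prop]
    constructor
    · rintro ⟨⟨m, hm⟩, hz⟩
      exact ⟨⟨max m k, le_max_right _ _, (hBV _ i).2.1 (hBmono i (le_max_left _ _) hm)⟩, hz⟩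
    · rintro ⟨⟨m, hm, hz⟩, hzk⟩
      have hm' : k ≤ m := hm
      exact ⟨⟨m + 1, (hBV m i).2.2 ⟨hz, (hK i).mono (by omega) hzk⟩⟩, hzk⟩
  refine Filter.mem_of_superset ((isOpen_set_pi finite_univ fun i _ => hUopen i).mem_nhds
    fun i _ => mem_iUnion.2 ⟨0, rfl⟩) fun z hz => ?_
  choose m hm using fun i => mem_iUnion.1 (hz i (mem_univ i))
  exact (B (Finset.univ.sup m)).2.2.2 fun i _ =>
    hBmono i (Finset.le_sup (Finset.mem_univ i)) (hm i)

theorem isClosed_pi_of_isCompactFiltration {K : ∀ i, ℕ → Set (X i)}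
    (hK : ∀ i, IsCompactFiltration (K i)) {C : Set (∀ i, X i)}
    (hC : ∀ k, IsClosed (C ∩ univ.pi fun i => K i k)) : IsClosed C := by
  rw [← isOpen_compl_iff]
  refine isOpen_pi_of_isCompactFiltration hK fun k => ⟨_, (hC k).isOpen_compl, ?_⟩
  ext z
  simp only [mem_inter_iff, mem_compl_iff]
  tauto

end Exhaustion

/-! ### Classifying spaces of products of finite groups -/

section Product

open CategoryTheory Simplicial Opposite Set

variable {G : Type u} [Group G]

/-- The `k`-skeleton of `BG`. -/
def skel (G : Type u) [Group G] (k : ℕ) : Set (BSpace G) :=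
  ⋃ n : Fin (k + 1), ⋃ x : (nerve (SingleObj G)) _⦋n⦌, range (cell x)

theorem mem_skel {k : ℕ} {z : BSpace G} :
    z ∈ skel G k ↔ ∃ n ≤ k, ∃ (x : (nerve (SingleObj G)) _⦋n⦌) (t : _), cell x t = z := by
  simp only [skel, mem_iUnion]
  constructor
  · rintro ⟨n, x, t, h⟩
    exact ⟨n, n.is_le, x, t, h⟩
  · rintro ⟨n, hn, x, t, h⟩
    exact ⟨⟨n, Nat.lt_succ_of_le hn⟩, x, t, h⟩

theorem isCompact_skel [Finite G] (k : ℕ) : IsCompact (skel G k) :=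
  isCompact_iUnion fun _ => isCompact_iUnion fun x => isCompact_range (cell x).continuous

theorem isCompactFiltration_skel [Finite G] : IsCompactFiltration (skel G) where
  mono k l h z hz := by
    obtain ⟨n, hn, hz⟩ := mem_skel.1 hz
    exact mem_skel.2 ⟨n, hn.trans h, hz⟩
  isCompact := isCompact_skel
  exists_mem z := by
    obtain ⟨n, x, t, rfl⟩ := exists_eq_cell z
    exact ⟨n, mem_skel.2 ⟨n, le_rfl, x, t, rfl⟩⟩
  isClosed_of_inter C hC := by
    refine isClosed_iff_cell.2 fun n x => ?_
    convert (hC n).preimage (cell x).continuous using 1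
    ext t
    exact ⟨fun h => ⟨h, mem_skel.2 ⟨n, le_rfl, x, t, rfl⟩⟩, fun h => h.1⟩

variable {ι : Type} (A : ι → Type u) [∀ i, Group (A i)]

/-- The map `B(∏ᵢ Aᵢ) → ∏ᵢ BAᵢ` induced by the projections. -/
def toPiB (z : BSpace (∀ i, A i)) (i : ι) : BSpace (A i) := BMap (Pi.evalMonoidHom A i) z

theorem continuous_toPiB : Continuous (toPiB A) :=
  continuous_pi fun i => (BMap (Pi.evalMonoidHom A i)).continuous

theorem stepFun_toPiB (z : BSpace (∀ i, A i)) (i : ι) (s : ℝ) :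
    stepFun (toPiB A z i) s = stepFun z s i :=
  stepFun_BMap _ _ _

theorem toPiB_injective : Function.Injective (toPiB A) := by
  intro z w h
  apply stepFun_injective
  funext s i
  rw [← stepFun_toPiB, ← stepFun_toPiB, h]

/-- The simplex of the nerve of a product of groups with prescribed components. -/
def nervePi {n : ℕ} (x : ∀ i, (nerve (SingleObj (A i))) _⦋n⦌) :
    (nerve (SingleObj (∀ i, A i))) _⦋n⦌ :=
  ({ obj := fun _ => SingleObj.star _
     map := fun f i =>
      (CategoryTheory.Functor.map (C := Fin (n + 1)) (D := SingleObj (A i)) (x i) f : A i)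
     map_id := fun j => funext fun i =>
      CategoryTheory.Functor.map_id (C := Fin (n + 1)) (D := SingleObj (A i)) (x i) j
     map_comp := fun f g => funext fun i =>
      CategoryTheory.Functor.map_comp (C := Fin (n + 1)) (D := SingleObj (A i)) (x i) f g } :
    Fin (n + 1) ⥤ SingleObj (∀ i, A i))

theorem nerveMap_nervePi {n : ℕ} (x : ∀ i, (nerve (SingleObj (A i))) _⦋n⦌) (i : ι) :
    (nerveMap (Pi.evalMonoidHom A i).toFunctor).app (op ⦋n⦌) (nervePi A x) = x i := by
  apply hol_injective
  rfl

/-- A common refinement represents all `y i` by simplices of one dimension at one point `s`, and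
these assemble into a simplex for the product group. The dimension bound is what closedness of
`toPiB` needs. -/
theorem exists_toPiB_eq [Fintype ι] {k : ℕ} {y : ∀ i, BSpace (A i)} (hy : ∀ i, y i ∈ skel (A i) k) :
    ∃ z ∈ skel (∀ i, A i) (∑ _ : ι, k), toPiB A z = y := by
  choose n hn x t h using fun i => mem_skel.1 (hy i)
  obtain ⟨N, hN, s, -, α, hα⟩ := exists_common_refinement n t
  let x' : ∀ i, (nerve (SingleObj (A i))) _⦋N⦌ := fun i => (nerve (SingleObj (A i))).map
    (Quiver.Hom.op (X := ⦋N⦌) (Y := ⦋n i⦌) (SimplexCategory.Hom.mk (α i))) (x i)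
  refine ⟨cell (nervePi A x') s, mem_skel.2 ⟨N, hN.trans (Finset.sum_le_sum fun i _ => hn i),
    _, s, rfl⟩, funext fun i => ?_⟩
  refine (BMap_cell _ _ _).trans ?_
  rw [nerveMap_nervePi, ← h i, ← hα i]
  exact cell_map (SimplexCategory.Hom.mk (a := ⦋N⦌) (b := ⦋n i⦌) (α i)) (x i) s

theorem toPiB_surjective [Fintype ι] [∀ i, Finite (A i)] : Function.Surjective (toPiB A) := by
  intro y
  choose k hk using fun i => isCompactFiltration_skel.exists_mem (y i)
  obtain ⟨z, -, hz⟩ := exists_toPiB_eq A (k := Finset.univ.sup k) (y := y) fun i =>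
    isCompactFiltration_skel.mono (Finset.le_sup (Finset.mem_univ i)) (hk i)
  exact ⟨z, hz⟩

/-- Over a product of `k`-skeleta only the part of `C` in one skeleton matters, by `exists_toPiB_eq`
and injectivity; that part is compact, so its image is closed. -/
theorem isClosedMap_toPiB [Fintype ι] [∀ i, Finite (A i)] : IsClosedMap (toPiB A) := by
  intro C hC
  refine isClosed_pi_of_isCompactFiltration (fun i => isCompactFiltration_skel) fun k => ?_
  have : toPiB A '' C ∩ univ.pi (fun i => skel (A i) k) =
      toPiB A '' (C ∩ skel (∀ i, A i) (∑ _ : ι, k)) ∩ univ.pi (fun i => skel (A i) k) := by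
    ext y
    constructor
    · rintro ⟨⟨z, hz, rfl⟩, hy⟩
      obtain ⟨w, hw, hwz⟩ := exists_toPiB_eq A fun i => hy i (mem_univ i)
      exact ⟨⟨z, ⟨hz, toPiB_injective A hwz ▸ hw⟩, rfl⟩, hy⟩
    · rintro ⟨⟨z, hz, rfl⟩, hy⟩
      exact ⟨⟨z, hz.1, rfl⟩, hy⟩
  rw [this]
  exact (((isCompact_skel _).inter_left hC).image (continuous_toPiB A)).isClosed.inter
    (isCompact_univ_pi fun i => isCompact_skel k).isClosed

/-- For finite groups `Aᵢ` the projections induce a homeomorphism `B(∏ᵢ Aᵢ) ≃ ∏ᵢ BAᵢ`. -/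
def piBHomeomorph [Fintype ι] [∀ i, Finite (A i)] : BSpace (∀ i, A i) ≃ₜ ∀ i, BSpace (A i) :=
  Equiv.toHomeomorphOfContinuousClosed
    (Equiv.ofBijective (toPiB A) ⟨toPiB_injective A, toPiB_surjective A⟩)
    (continuous_toPiB A) (isClosedMap_toPiB A)

theorem stepFun_piBHomeomorph_symm [Fintype ι] [∀ i, Finite (A i)]
    (y : ∀ i, BSpace (A i)) (s : ℝ) (i : ι) :
    stepFun ((piBHomeomorph A).symm y) s i = stepFun (y i) s := by
  rw [← stepFun_toPiB]
  exact congrArg (fun y : ∀ i, BSpace (A i) => stepFun (y i) s)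
    ((piBHomeomorph A).apply_symm_apply y)

end Product

/-! ### Extension over the polyhedral product -/

section Extension

open Set

variable {G : Type u} [Group G] {n : ℕ} (H : Fin n → Subgroup G)

theorem commute_of_mem_flagComplex {σ : Finset (Fin n)}
    (hσ : σ = ∅ ∨ σ ∈ flagComplex (graphComplex (commutationGraph H))) {i j : Fin n}
    (hi : i ∈ σ) (hj : j ∈ σ) (hij : i ≠ j) {a b : G} (ha : a ∈ H i) (hb : b ∈ H j) :
    Commute a b := by
  rcases hσ with rfl | hσ
  · simp at hi
  · have hadj : (commutationGraph H).Adj i j := by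
      rcases hσ.2 i hi j hj hij with ⟨v, hv⟩ | ⟨v, w, hvw, h⟩
      · have h1 : i ∈ ({v} : Finset (Fin n)) := hv ▸ by simp
        have h2 : j ∈ ({v} : Finset (Fin n)) := hv ▸ by simp
        rw [Finset.mem_singleton] at h1 h2
        exact absurd (h1.trans h2.symm) hij
      · have h1 : i ∈ ({v, w} : Finset (Fin n)) := h ▸ by simp
        have h2 : j ∈ ({v, w} : Finset (Fin n)) := h ▸ by simp
        rw [Finset.mem_insert, Finset.mem_singleton] at h1 h2
        rcases h1 with rfl | rfl <;> rcases h2 with rfl | rfl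
        · exact absurd rfl hij
        · exact hvw
        · exact hvw.symm
        · exact absurd rfl hij
    exact Subgroup.mem_centralizer_iff.1
      (Subgroup.commutator_eq_bot_iff_le_centralizer.1 hadj.symm.2 hb) a ha

/-- The inclusion `Hᵢ → G` if `i ∈ σ`, and the trivial homomorphism otherwise. -/
def truncatedInclusion (σ : Finset (Fin n)) (i : Fin n) : H i →* G :=
  if i ∈ σ then (H i).subtype else 1

theorem truncatedInclusion_apply {σ : Finset (Fin n)} {i : Fin n} {a : H i} (h : i ∉ σ → a = 1) :
    truncatedInclusion H σ i a = a := by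
  unfold truncatedInclusion
  split_ifs with hi
  · rfl
  · rw [h hi]
    rfl

theorem pairwise_commute_truncatedInclusion {σ : Finset (Fin n)}
    (hσ : σ = ∅ ∨ σ ∈ flagComplex (graphComplex (commutationGraph H))) :
    Pairwise fun i j => ∀ (a : H i) (b : H j),
      Commute (truncatedInclusion H σ i a) (truncatedInclusion H σ j b) := by
  intro i j hij a b
  unfold truncatedInclusion
  split_ifs with hi hj
  · exact commute_of_mem_flagComplex H hσ hi hj hij a.2 b.2
  · exact Commute.one_right _
  · exact Commute.one_left _
  · exact Commute.one_left _

variable [Finite G]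

/-- For pairwise commuting `Hᵢ`, `i ∈ σ`, the map `∏ᵢ BHᵢ → BG` induced by the multiplication of
the factors in `σ`. -/
def simplexMap {σ : Finset (Fin n)}
    (hσ : σ = ∅ ∨ σ ∈ flagComplex (graphComplex (commutationGraph H))) :
    C(∀ i, BSpace (H i), BSpace G) :=
  (BMap (MonoidHom.noncommPiCoprod _ (pairwise_commute_truncatedInclusion H hσ))).comp
    (piBHomeomorph fun i => H i).symm

theorem stepFun_simplexMap {σ : Finset (Fin n)}
    (hσ : σ = ∅ ∨ σ ∈ flagComplex (graphComplex (commutationGraph H))) (z : ∀ i, BSpace (H i))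
    (s : ℝ) :
    stepFun (simplexMap H hσ z) s =
      MonoidHom.noncommPiCoprod _ (pairwise_commute_truncatedInclusion H hσ)
        (fun i => stepFun (z i) s) := by
  refine (stepFun_BMap _ _ s).trans (congrArg _ (funext fun i => ?_))
  exact stepFun_piBHomeomorph_symm (fun i => H i) z s i

/-- At each time both sides are the ordered product of the values `stepFun (z i) s`: a truncated
factor has `z i` at the basepoint, where this value is already `1`. -/
theorem simplexMap_eq {σ τ : Finset (Fin n)}
    (hσ : σ = ∅ ∨ σ ∈ flagComplex (graphComplex (commutationGraph H)))
    (hτ : τ = ∅ ∨ τ ∈ flagComplex (graphComplex (commutationGraph H))) {z : ∀ i, BSpace (H i)}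
    (hzσ : ∀ i ∉ σ, z i ∈ ({basePoints H i} : Set _))
    (hzτ : ∀ i ∉ τ, z i ∈ ({basePoints H i} : Set _)) :
    simplexMap H hσ z = simplexMap H hτ z := by
  apply stepFun_injective
  funext s
  rw [stepFun_simplexMap, stepFun_simplexMap]
  have h1 : ∀ i, z i ∈ ({basePoints H i} : Set _) → stepFun (z i) s = 1 := by
    intro i hi
    rw [mem_singleton_iff.1 hi, stepFun_basePoint]
  simp only [MonoidHom.noncommPiCoprod, MonoidHom.coe_mk, OneHom.coe_mk]
  refine Finset.noncommProd_congr rfl (fun i _ => ?_) _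
  rw [truncatedInclusion_apply H fun hi => h1 i (hzσ i hi),
    truncatedInclusion_apply H fun hi => h1 i (hzτ i hi)]

theorem simplexMap_axis {σ : Finset (Fin n)}
    (hσ : σ = ∅ ∨ σ ∈ flagComplex (graphComplex (commutationGraph H))) {i : Fin n} (hi : i ∈ σ)
    (a : BSpace (H i)) :
    simplexMap H hσ (Function.update (basePoints H) i a) = BMap (H i).subtype a := by
  apply stepFun_injective
  funext s
  rw [stepFun_simplexMap, stepFun_BMap]
  have : (fun j => stepFun (Function.update (basePoints H) i a j) s) =
      Pi.mulSingle i (stepFun a s) := by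
    funext j
    rcases eq_or_ne j i with rfl | hj
    · simp
    · rw [Function.update_of_ne hj, Pi.mulSingle_eq_of_ne hj, stepFun_basePoint]
  rw [this, MonoidHom.noncommPiCoprod_mulSingle, truncatedInclusion_apply H (absurd hi)]
  rfl

theorem extendsTo_of_le_flagComplex {K : AbstractSimplicialComplex (Fin n)}
    (hK : K ≤ flagComplex (graphComplex (commutationGraph H))) : ExtendsTo H K := by
  have hflag : ∀ {σ : Finset (Fin n)}, σ = ∅ ∨ σ ∈ K →
      σ = ∅ ∨ σ ∈ flagComplex (graphComplex (commutationGraph H)) := fun h => h.imp_right (@hK _)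
  choose σ hσ hzσ using fun z : PointedPolyhedralProduct K (basePoints H) => z.2
  let F : PointedPolyhedralProduct K (basePoints H) → BSpace G := fun z =>
    simplexMap H (hflag (hσ z)) z.1
  have hF : ∀ (τ : Finset (Fin n)) (hτ : τ = ∅ ∨ τ ∈ K) z,
      (∀ i ∉ τ, z.1 i ∈ ({basePoints H i} : Set _)) → F z = simplexMap H (hflag hτ) z.1 :=
    fun τ hτ z hz => simplexMap_eq H _ _ (hzσ z) hz
  have hcont : Continuous F := by
    let D : {τ : Finset (Fin n) // τ = ∅ ∨ τ ∈ K} →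
        Set (PointedPolyhedralProduct K (basePoints H)) := fun τ =>
      {z | ∀ i ∉ τ.1, z.1 i ∈ ({basePoints H i} : Set _)}
    -- The pieces `D τ` are closed because points of the Hausdorff spaces `BHᵢ` are closed.
    refine (locallyFinite_of_finite D).continuous ?_ (fun τ => ?_) fun τ => ?_
    · exact eq_univ_of_forall fun z => mem_iUnion.2 ⟨⟨σ z, hσ z⟩, hzσ z⟩
    · simp only [D, ofPred_forall]
      exact isClosed_iInter fun i => isClosed_iInter fun _ =>
        isClosed_singleton.preimage ((continuous_apply i).comp continuous_subtype_val)
    · exact ((simplexMap H (hflag τ.2)).continuous.comp continuous_subtype_val).continuousOn.congr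
        fun z hz => hF τ.1 τ.2 z hz
  refine ⟨⟨F, hcont⟩, ?_⟩
  have hbase : F ⟨basePoints H, ∅, Or.inl rfl, fun _ _ => rfl⟩ = basePoint G := by
    apply stepFun_injective
    funext s
    rw [stepFun_basePoint, stepFun_simplexMap]
    refine (congrArg _ (funext fun i => stepFun_basePoint s)).trans ?_
    exact map_one _
  ext z
  rcases z with ⟨⟨⟩ | ⟨i, a⟩⟩
  · exact hbase
  · refine (hF {i} (Or.inr (K.singleton_mem i)) (axisInclusion K (basePoints H) i a)
      fun j hj => ?_).trans (simplexMap_axis H _ (Finset.mem_singleton_self i) a)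
    exact Function.update_of_ne (fun h => hj (Finset.mem_singleton.2 h)) _ _

end Extension

end PolyhedralExtension

end


theorem mainTheorem11 {G : Type u} [Group G] [Finite G] (hG : Subgroup.center G = ⊥)
    {n : ℕ} (H : Fin n → Subgroup G) :
    PolyhedralExtension.ExtendsTo H
      (PolyhedralExtension.flagComplex
        (PolyhedralExtension.graphComplex (PolyhedralExtension.commutationGraph H))) ∧
    ∀ K : AbstractSimplicialComplex (Fin n),
      PolyhedralExtension.graphComplex (PolyhedralExtension.commutationGraph H) ≤ K →
      K ≤ PolyhedralExtension.flagComplex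
        (PolyhedralExtension.graphComplex (PolyhedralExtension.commutationGraph H)) →
      PolyhedralExtension.ExtendsTo H K :=
  ⟨PolyhedralExtension.extendsTo_of_le_flagComplex H le_rfl,
    fun _ _ hK => PolyhedralExtension.extendsTo_of_le_flagComplex H hK⟩
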